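/- Let $p$ be a prime, $h\ge 1$ an integer and $q=p^h$. Let $K$ be a field of characteristic $p$ (for instance $\mathbb{F}_{q^2}$ or its algebraic closure) and let $\omega\in K$ satisfy $\omega^{q-1}=-1$. Consider the two affine plane curves $$\sum_{i=1}^{h}Y^{q/p^i}+\omega X^{q+1}=0\quad(\text{where } h\ge 2),\qquad \sum_{i=1}^{h}Y^{q/p^i}+\omega X^{(q+1)/d}=0\quad(\text{where } d\ge 1,\ d\mid q+1).$$ Each of these curves is irreducible over $K$, its projective closure in $\mathbb{P}^2$ has exactly one $K$-rational point on the line at infinity, and exactly one place $P_\infty$ of its function field $K(x,y)$ is centred at that point. The Weierstrass semigroup at $P_\infty$, $$H(P_\infty)=\{n\in\mathbb{Z}_{\ge 0} : \text{there is } f\in K(x,y) \text{ with pole divisor } nP_\infty\},$$ is generated (as a submonoid of $\mathbb{Z}_{\ge 0}$) by $q/p$ and $q+1$ for the first curve, and by $q/p$ and $(q+1)/d$ for the second curve. -/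

import Mathlib

/-! ### Places of a function field and Weierstrass semigroups -/

/-- A place of the field extension `F / K`, given by its valuation ring: a proper valuation
subring of `F` that contains the constants `K`. -/
structure Place (K F : Type*) [Field K] [Field F] [Algebra K F] where
  ring : ValuationSubring F
  algebraMap_mem : ∀ c : K, algebraMap K F c ∈ ring
  ne_top : ring ≠ ⊤

namespace Place

variable {K F : Type*} [Field K] [Field F] [Algebra K F]

/-- `t` is a local parameter at `P`: it generates the maximal ideal of the valuation ring. -/
def IsLocalParameter (P : Place K F) (t : F) : Prop :=
  ∃ ht : t ∈ P.ring,
    IsLocalRing.maximalIdeal P.ring = Ideal.span {(⟨t, ht⟩ : P.ring)}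

/-- `ord_P(f) = -n`: for some local parameter `t` at `P`, the function `f * t ^ n` is a unit of
the valuation ring. -/
def HasPoleOrder (P : Place K F) (f : F) (n : ℕ) : Prop :=
  ∃ t : F, P.IsLocalParameter t ∧ P.ring.valuation (f * t ^ n) = 1

/-- The Weierstrass semigroup at `P`: all `n` such that some `f` has pole divisor `n P`, that is,
`f` is regular at all other places and `ord_P(f) = -n`. -/
def weierstrassSemigroup (P : Place K F) : Set ℕ :=
  {n | ∃ f : F, (∀ Q : Place K F, Q ≠ P → f ∈ Q.ring) ∧ P.HasPoleOrder f n}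

end Place

/-! ### Affine plane curves, their points at infinity and their function fields -/

namespace PlaneCurve

variable {K : Type*} [Field K]

/-- The homogenization of `f(X, Y)` in the variables `X`, `Y`, `Z` (indices `0`, `1`, `2`). -/
noncomputable def homogenization (f : MvPolynomial (Fin 2) K) : MvPolynomial (Fin 3) K :=
  ∑ i ∈ Finset.range (f.totalDegree + 1),
    MvPolynomial.rename Fin.castSucc (MvPolynomial.homogeneousComponent i f) *
      MvPolynomial.X 2 ^ (f.totalDegree - i)

/-- A point of the projective plane that lies on the projective closure of `f = 0` and on the
line at infinity `Z = 0`. -/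
def IsPointAtInfinity (f : MvPolynomial (Fin 2) K)
    (pt : Projectivization K (Fin 3 → K)) : Prop :=
  MvPolynomial.eval pt.rep (homogenization f) = 0 ∧ pt.rep 2 = 0

/-- The coordinate ring `K[X, Y] / (f)`. -/
abbrev CoordinateRing (f : MvPolynomial (Fin 2) K) : Type _ :=
  MvPolynomial (Fin 2) K ⧸ Ideal.span {f}

/-- The function field `K(x, y)` with `f(x, y) = 0`; it is a field once the coordinate ring is
a domain. -/
abbrev FunctionField (f : MvPolynomial (Fin 2) K) : Type _ :=
  FractionRing (CoordinateRing f)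

/-- The coordinate function `x` (for `i = 0`) or `y` (for `i = 1`). -/
noncomputable def coord (f : MvPolynomial (Fin 2) K) (i : Fin 2) : FunctionField f :=
  algebraMap (CoordinateRing f) (FunctionField f)
    (Ideal.Quotient.mk (Ideal.span {f}) (MvPolynomial.X i))

/-- The place `P` is centred at the point `pt` of the projective plane: after multiplication by
some function `c`, the homogeneous coordinate functions `(x : y : 1)` are regular at `P`
and take there the values given by the homogeneous coordinates of `pt`. -/
def IsCentredAt (f : MvPolynomial (Fin 2) K) [IsDomain (CoordinateRing f)]
    (P : Place K (FunctionField f)) (pt : Projectivization K (Fin 3 → K)) : Prop :=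
  ∃ c : FunctionField f, ∀ i : Fin 3,
    P.ring.valuation
      (c * ![coord f 0, coord f 1, 1] i - algebraMap K (FunctionField f) (pt.rep i)) < 1

/-- The curve `f = 0` is irreducible, its projective closure has a unique point at infinity,
there is a unique place centred at that point, and the Weierstrass semigroup at that place
is `S`. -/
def HasWeierstrassSemigroupAtInfinity (f : MvPolynomial (Fin 2) K) (S : AddSubmonoid ℕ) : Prop :=
  ∃ _ : IsDomain (CoordinateRing f), ∃ pt : Projectivization K (Fin 3 → K),
    (∀ pt', IsPointAtInfinity f pt' ↔ pt' = pt) ∧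
    ∃ P : Place K (FunctionField f),
      (∀ Q : Place K (FunctionField f), IsCentredAt f Q pt ↔ Q = P) ∧
      P.weierstrassSemigroup = (S : Set ℕ)

/-- The polynomial `∑_{i=1}^h Y^{q/p^i} + ω X^m`, where `q = p^h`. -/
noncomputable def traceCurve (p h : ℕ) (ω : K) (m : ℕ) : MvPolynomial (Fin 2) K :=
  (∑ i ∈ Finset.Icc 1 h, MvPolynomial.X 1 ^ (p ^ h / p ^ i)) +
    MvPolynomial.C ω * MvPolynomial.X 0 ^ m

end PlaneCurve

/-!
Let `T` be monic of degree `n` prime to `m`. At a place where `x` or `y` has a pole, the equation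
`T(y) + ω x ^ m = 0` forces `v(x) ^ m = v(y) ^ n`, hence `v(x) = γ ^ n` and `v(y) = γ ^ m` for some
`γ > 1`. The monomials `x ^ i * y ^ j` with `j < n` then have pairwise distinct values, so the value
of a polynomial in `x` and `y` of degree less than `n` in `y` is `γ` to its weighted degree. In
particular no such nonzero polynomial vanishes on the curve, which makes the curve irreducible; `x`
has a pole at only one place; and the nonzero elements of the coordinate ring have there as values
the powers of `γ` with exponent in the semigroup generated by `n` and `m`.

If moreover the derivative of `T` is a nonzero constant, then the coordinate ring is étale over
`K[X]`, hence integrally closed, so it consists of all functions regular away from infinity. For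
`T = ∑ Y ^ (q / p ^ i)` in characteristic `p` the derivative is `1`.
-/

open Polynomial

namespace Place

section Ring

variable {K F : Type*} [Field K] [Field F] [Algebra K F]

theorem ring_injective : Function.Injective (ring : Place K F → ValuationSubring F) := by
  rintro ⟨_, _, _⟩ ⟨_, _, _⟩ rfl
  rfl

instance isTrivialOn_valuation (P : Place K F) : P.ring.valuation.IsTrivialOn K :=
  Valuation.IsTrivialOn.of_le_one _ fun c ↦
    (P.ring.valuation_le_one_iff _).mpr (P.algebraMap_mem c)

/-- The valuation ring of a place as a subalgebra over the constants, so that polynomial expressions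
in regular functions are regular. -/
def subalgebra (P : Place K F) : Subalgebra K F :=
  { P.ring.toSubring with algebraMap_mem' := P.algebraMap_mem }

theorem exists_notMem_of_not_isIntegral {A : Type*} [CommRing A] [Algebra K A] [Algebra A F]
    [IsScalarTower K A F] {z : F} (hz : ¬ IsIntegral A z) :
    ∃ P : Place K F, (∀ a, algebraMap A F a ∈ P.ring) ∧ z ∉ P.ring := by
  have : IsIntegrallyClosedIn (integralClosure A F).toSubring F :=
    inferInstanceAs (IsIntegrallyClosedIn (integralClosure A F) F)
  obtain ⟨V, hV, hzV⟩ :=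
    Subring.exists_le_valuationSubring_of_isIntegrallyClosedIn (x := z)
      (R := (integralClosure A F).toSubring) hz
  have hA (a : A) : algebraMap A F a ∈ V := hV ((integralClosure A F).algebraMap_mem a)
  refine ⟨⟨V, fun c ↦ ?_, fun h ↦ hzV (h ▸ ValuationSubring.mem_top z)⟩, hA, hzV⟩
  rw [IsScalarTower.algebraMap_apply K A F]
  exact hA _

end Ring

section LocalParameter

variable {K F : Type*} [Field K] [Field F] [Algebra K F] {P : Place K F} {s t z : F}

theorem isLocalParameter_iff : P.IsLocalParameter t ↔ P.ring.valuation t < 1 ∧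
    ∀ z, P.ring.valuation z < 1 → P.ring.valuation z ≤ P.ring.valuation t := by
  have hdvd (a b : P.ring) :
      a ∈ Ideal.span {b} ↔ P.ring.valuation (a : F) ≤ P.ring.valuation (b : F) := by
    rw [Ideal.mem_span_singleton]
    exact Valuation.Integers.dvd_iff_le
      ⟨Subtype.val_injective, P.ring.valuation_le_one, fun _ hx ↦
        ⟨⟨_, (P.ring.valuation_le_one_iff _).mp hx⟩, rfl⟩⟩
  constructor
  · rintro ⟨ht, hmax⟩
    refine ⟨?_, fun z hz ↦ ?_⟩
    · rw [← ValuationSubring.valuation_lt_one_iff P.ring ⟨t, ht⟩, hmax]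
      exact Ideal.mem_span_singleton_self _
    · have hzmem : z ∈ P.ring := (P.ring.valuation_le_one_iff z).mp hz.le
      rwa [← ValuationSubring.valuation_lt_one_iff P.ring ⟨z, hzmem⟩, hmax, hdvd] at hz
  · rintro ⟨ht, hle⟩
    refine ⟨(P.ring.valuation_le_one_iff t).mp ht.le, Ideal.ext fun a ↦ ?_⟩
    rw [ValuationSubring.valuation_lt_one_iff, hdvd]
    exact ⟨hle _, fun h ↦ h.trans_lt ht⟩

theorem IsLocalParameter.valuation_eq (hs : P.IsLocalParameter s) (ht : P.IsLocalParameter t) :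
    P.ring.valuation s = P.ring.valuation t := by
  rw [isLocalParameter_iff] at hs ht
  exact le_antisymm (ht.2 s hs.1) (hs.2 t ht.1)

theorem IsLocalParameter.hasPoleOrder_iff (hs : P.IsLocalParameter s⁻¹) (hs0 : s ≠ 0) {n : ℕ} :
    P.HasPoleOrder z n ↔ P.ring.valuation z = P.ring.valuation s ^ n := by
  have hvs : P.ring.valuation s ^ n ≠ 0 :=
    pow_ne_zero _ ((P.ring.valuation.ne_zero_iff).mpr hs0)
  have hiff {t : F} (ht : P.IsLocalParameter t) :
      P.ring.valuation (z * t ^ n) = 1 ↔ P.ring.valuation z = P.ring.valuation s ^ n := by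
    rw [map_mul, map_pow, ht.valuation_eq hs, map_inv₀, inv_pow, mul_inv_eq_one₀ hvs]
  exact ⟨fun ⟨_, ht, h⟩ ↦ (hiff ht).mp h, fun h ↦ ⟨_, hs, (hiff hs).mpr h⟩⟩

/-- Every value is a power of `v s`, so no value lies strictly between `1` and `v s`. -/
theorem isLocalParameter_inv (hs : 1 < P.ring.valuation s)
    (hgen : ∀ z : F, z ≠ 0 → ∃ k : ℤ, P.ring.valuation z = P.ring.valuation s ^ k) :
    P.IsLocalParameter s⁻¹ := by
  rw [isLocalParameter_iff, map_inv₀]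
  refine ⟨inv_lt_one_of_one_lt₀ hs, fun z hz ↦ ?_⟩
  rcases eq_or_ne z 0 with rfl | hz0
  · simp
  obtain ⟨k, hk⟩ := hgen z hz0
  rw [hk, zpow_lt_one_iff_right₀ hs] at hz
  rw [hk, ← zpow_neg_one]
  exact zpow_le_zpow_right₀ hs.le (by omega)

end LocalParameter

section SeparatedEquation

variable {K F : Type*} [Field K] [Field F] [Algebra K F] {P : Place K F}
  {T : K[X]} {ω : K} {m : ℕ} {x y : F}

theorem valuation_aeval_of_notMem (hT0 : T.natDegree ≠ 0) (hy : y ∉ P.ring) :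
    P.ring.valuation (aeval y T) = P.ring.valuation y ^ T.natDegree := by
  rw [← P.ring.valuation_le_one_iff, not_le] at hy
  exact valuation_aeval_eq_valuation_X_pow_natDegree_of_one_lt_valuation_X y hy
    (ne_zero_of_natDegree_gt (Nat.pos_of_ne_zero hT0))

theorem aeval_mem_ring_iff (hT0 : T.natDegree ≠ 0) : aeval y T ∈ P.ring ↔ y ∈ P.ring := by
  refine ⟨fun h ↦ ?_, fun hy ↦
    Algebra.adjoin_singleton_le (S := P.subalgebra) hy (aeval_mem_adjoin_singleton K y)⟩
  by_contra hy
  rw [← P.ring.valuation_le_one_iff, valuation_aeval_of_notMem hT0 hy,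
    pow_le_one_iff_of_nonneg zero_le hT0, P.ring.valuation_le_one_iff] at h
  exact hy h

theorem valuation_pow_eq_valuation_aeval (hω : ω ≠ 0)
    (hxy : aeval y T + algebraMap K F ω * x ^ m = 0) :
    P.ring.valuation x ^ m = P.ring.valuation (aeval y T) := by
  rw [eq_neg_of_add_eq_zero_left hxy, Valuation.map_neg, map_mul, map_pow,
    Valuation.IsTrivialOn.eq_one ω hω, one_mul]

theorem mem_ring_iff_mem_ring (hω : ω ≠ 0) (hm : m ≠ 0) (hT0 : T.natDegree ≠ 0)
    (hxy : aeval y T + algebraMap K F ω * x ^ m = 0) : x ∈ P.ring ↔ y ∈ P.ring := by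
  rw [← aeval_mem_ring_iff (y := y) hT0, ← P.ring.valuation_le_one_iff,
    ← P.ring.valuation_le_one_iff, ← valuation_pow_eq_valuation_aeval hω hxy,
    pow_le_one_iff_of_nonneg zero_le hm]

theorem exists_valuation_eq_pow (hω : ω ≠ 0) (hm : m ≠ 0) (hT0 : T.natDegree ≠ 0)
    (hcop : T.natDegree.Coprime m) (hxy : aeval y T + algebraMap K F ω * x ^ m = 0)
    (hx : x ∉ P.ring) :
    ∃ s : F, 1 < P.ring.valuation s ∧ P.ring.valuation x = P.ring.valuation s ^ T.natDegree ∧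
      P.ring.valuation y = P.ring.valuation s ^ m := by
  have hy : y ∉ P.ring := mt (mem_ring_iff_mem_ring hω hm hT0 hxy).mpr hx
  have hvxy : P.ring.valuation x ^ m = P.ring.valuation y ^ T.natDegree := by
    rw [valuation_pow_eq_valuation_aeval hω hxy, valuation_aeval_of_notMem hT0 hy]
  obtain ⟨γ, hγx, hγy⟩ := (pow_eq_pow_iff_of_coprime hcop.symm).mp hvxy
  obtain ⟨s, rfl⟩ := P.ring.valuation_surjective γ
  rw [← P.ring.valuation_le_one_iff, not_le, hγx, one_lt_pow_iff_of_nonneg zero_le hT0] at hx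
  exact ⟨s, hx, hγx, hγy⟩

end SeparatedEquation

end Place

namespace PlaneCurve

/-- The weighted degree of `p(X, Y)` for the weights `n` of `X` and `m` of `Y`, where `p` is given
as a polynomial in `Y` with coefficients in `K[X]`. -/
noncomputable def weightedDegree {K : Type*} [Semiring K] (n m : ℕ) (p : K[X][X]) : ℕ :=
  p.support.sup fun j ↦ (p.coeff j).natDegree * n + j * m

theorem weightedDegree_mem_closure {K : Type*} [Semiring K] (n m : ℕ) (p : K[X][X]) :
    weightedDegree n m p ∈ AddSubmonoid.closure {n, m} := by
  rcases p.support.eq_empty_or_nonempty with hempty | hne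
  · simp [weightedDegree, hempty]
  · obtain ⟨j, -, hj⟩ :=
      p.support.exists_mem_eq_sup hne fun j ↦ (p.coeff j).natDegree * n + j * m
    rw [weightedDegree, hj, AddSubmonoid.mem_closure_pair]
    exact ⟨_, _, rfl⟩

theorem eq_of_mul_add_mul_eq {n m : ℕ} (hnm : n.Coprime m) {a b i j : ℕ} (hi : i < n) (hj : j < n)
    (h : a * n + i * m = b * n + j * m) : i = j := by
  have hmod : i * m ≡ j * m [MOD n] := by
    simpa [Nat.ModEq] using congrArg (· % n) h
  exact (Nat.ModEq.cancel_right_of_coprime hnm hmod).eq_of_lt_of_lt hi hj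

variable {K L Γ : Type*} [Field K] [Field L] [Algebra K L] [LinearOrderedCommGroupWithZero Γ]
  {v : Valuation L Γ} [v.IsTrivialOn K] {n m : ℕ} {x y : L} {γ : Γ}

theorem valuation_aeval_mul_pow (hγ : 1 < γ) (hn : n ≠ 0) (hx : v x = γ ^ n) (hy : v y = γ ^ m)
    {a : K[X]} (ha : a ≠ 0) (j : ℕ) :
    v (aeval x a * y ^ j) = γ ^ (a.natDegree * n + j * m) := by
  have hvx : 1 < v x := hx ▸ one_lt_pow₀ hγ hn
  rw [map_mul, map_pow,
    valuation_aeval_eq_valuation_X_pow_natDegree_of_one_lt_valuation_X x hvx ha, hx, hy,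
    ← pow_mul, ← pow_mul, ← pow_add, mul_comm n, mul_comm m]

/-- The monomials `x ^ i * y ^ j` with `j < n` have pairwise distinct values, so the value of
`p(x, y)` is that of its dominant monomial. -/
theorem valuation_aevalAeval_eq_pow_weightedDegree (hnm : n.Coprime m) (hγ : 1 < γ)
    (hx : v x = γ ^ n) (hy : v y = γ ^ m) {p : K[X][X]} (hp : p ≠ 0) (hpn : p.natDegree < n) :
    v (aevalAeval x y p) = γ ^ weightedDegree n m p := by
  have hterm {j : ℕ} (hj : j ∈ p.support) :
      v (aeval x (p.coeff j) * y ^ j) = γ ^ ((p.coeff j).natDegree * n + j * m) :=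
    valuation_aeval_mul_pow hγ (by omega) hx hy (mem_support_iff.mp hj) j
  have hlt {j : ℕ} (hj : j ∈ p.support) : j < n := (le_natDegree_of_mem_supp j hj).trans_lt hpn
  have hsum : aevalAeval x y p = ∑ j ∈ p.support, aeval x (p.coeff j) * y ^ j := by
    conv_lhs => rw [p.as_sum_support_C_mul_X_pow]
    simp
  obtain ⟨j, hj, hjmax⟩ := p.support.exists_mem_eq_sup (support_nonempty.mpr hp)
    fun j ↦ (p.coeff j).natDegree * n + j * m
  rw [weightedDegree, hjmax, hsum, ← hterm hj]
  refine v.map_sum_eq_of_lt hj fun i hi ↦ ?_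
  obtain ⟨hi, hij⟩ := Finset.mem_sdiff.mp hi
  rw [hterm hi, hterm hj]
  refine pow_lt_pow_right₀ hγ (lt_of_le_of_ne ?_ fun heq ↦
    hij (Finset.mem_singleton.mpr (eq_of_mul_add_mul_eq hnm (hlt hi) (hlt hj) heq)))
  exact (Finset.le_sup (f := fun j ↦ (p.coeff j).natDegree * n + j * m) hi).trans_eq hjmax

end PlaneCurve

section FractionField

variable {R B F : Type*} [CommRing R] [CommRing B] [Field F] [Algebra R B] [Algebra B F]
  [Algebra R F] [IsScalarTower R B F] {y : B}

theorem adjoin_algebraMap_eq_range (hadj : Algebra.adjoin R {y} = ⊤) :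
    Algebra.adjoin R {algebraMap B F y} = (IsScalarTower.toAlgHom R B F).range := by
  rw [← Set.image_singleton, Algebra.adjoin_algebraMap, hadj, Algebra.map_top]

theorem intermediateField_adjoin_algebraMap_eq_top (k : Type*) [Field k] [Algebra R k] [Algebra k F]
    [IsScalarTower R k F] [IsFractionRing B F] (hadj : Algebra.adjoin R {y} = ⊤) :
    IntermediateField.adjoin k {algebraMap B F y} = ⊤ := by
  have hB (b : B) : algebraMap B F b ∈ IntermediateField.adjoin k {algebraMap B F y} := by
    have hle : Algebra.adjoin R {algebraMap B F y} ≤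
        (IntermediateField.adjoin k {algebraMap B F y}).toSubalgebra.restrictScalars R :=
      Algebra.adjoin_singleton_le (IntermediateField.mem_adjoin_simple_self k _)
    rw [adjoin_algebraMap_eq_range hadj] at hle
    exact hle ⟨b, rfl⟩
  rw [eq_top_iff]
  rintro z -
  obtain ⟨a, b, -, rfl⟩ := IsFractionRing.div_surjective (A := B) z
  exact div_mem (hB a) (hB b)

end FractionField

section SeparableGenerator

variable {k F : Type*} [Field k] [Field F] [Algebra k F] {y : F}

theorem isSeparable_of_aeval_derivative_minpoly_ne_zero (hy : IsIntegral k y)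
    (hder : aeval y (derivative (minpoly k y)) ≠ 0) : IsSeparable k y := by
  refine (separable_iff_derivative_ne_zero (minpoly.irreducible hy)).mpr fun h ↦ hder ?_
  rw [h, map_zero]

theorem algebra_isSeparable_of_adjoin_eq_top (hadj : IntermediateField.adjoin k {y} = ⊤)
    (hy : IsSeparable k y) : Algebra.IsSeparable k F := by
  have h : Algebra.IsSeparable k (IntermediateField.adjoin k {y}) :=
    (IntermediateField.isSeparable_adjoin_simple_iff_isSeparable k F).mpr hy
  rw [hadj] at h
  exact Algebra.IsSeparable.of_algHom k _
    (IntermediateField.topEquiv (F := k) (E := F)).symm.toAlgHom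

end SeparableGenerator

section IntegrallyClosed

variable {R : Type*} [CommRing R] [IsDomain R] [IsIntegrallyClosed R]

/-- By integrality of traces, `z` lies in the trace dual of `R[y]`, which by Euler's formula is
generated by the inverse of the value of the derivative at `y`. -/
theorem mem_adjoin_of_inv_aeval_derivative_minpoly_mem (k : Type*) {F : Type*} [Field k] [Field F]
    [Algebra R k] [IsFractionRing R k] [Algebra k F] [Algebra R F] [IsScalarTower R k F]
    [FiniteDimensional k F] [Algebra.IsSeparable k F] {y z : F}
    (hadj : Algebra.adjoin k {y} = ⊤) (hy : IsIntegral R y)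
    (hder : (aeval y (derivative (minpoly k y)))⁻¹ ∈ Algebra.adjoin R {y})
    (hz : IsIntegral R z) : z ∈ Algebra.adjoin R {y} := by
  have hdual : z ∈ (Algebra.traceForm k F).dualSubmodule
      (Subalgebra.toSubmodule (Algebra.adjoin R {y})) := by
    rw [LinearMap.BilinForm.mem_dualSubmodule]
    intro w hw
    have hw' : IsIntegral R w := adjoin_le_integralClosure hy hw
    rw [Algebra.traceForm_apply, Submodule.mem_one]
    exact IsIntegrallyClosed.isIntegral_iff.mp (Algebra.isIntegral_trace (hz.mul hw'))
  rw [traceForm_dualSubmodule_adjoin R k hadj hy] at hdual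
  obtain ⟨w, hw, rfl⟩ := hdual
  exact mul_mem hder hw

theorem aeval_derivative_minpoly_algebraMap (k F : Type*) {B : Type*} [Field k] [Field F]
    [CommRing B] [Algebra R k] [IsFractionRing R k] [Algebra k F] [Algebra R F]
    [IsScalarTower R k F] [Algebra R B] [Algebra B F] [IsScalarTower R B F] [FaithfulSMul B F]
    {y : B} (hy : IsIntegral R y) :
    aeval (algebraMap B F y) (derivative (minpoly k (algebraMap B F y))) =
      algebraMap B F (aeval y (derivative (minpoly R y))) := by
  have hyF : IsIntegral R (algebraMap B F y) := hy.map (IsScalarTower.toAlgHom R B F)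
  rw [minpoly.isIntegrallyClosed_eq_field_fractions' k hyF,
    minpoly.algebraMap_eq (FaithfulSMul.algebraMap_injective B F), derivative_map,
    aeval_map_algebraMap, aeval_algebraMap_apply]

theorem isIntegrallyClosed_of_isUnit_aeval_derivative_minpoly {B : Type*} [CommRing B] [IsDomain B]
    [Algebra R B] [FaithfulSMul R B] {y : B} (hy : IsIntegral R y)
    (hadj : Algebra.adjoin R {y} = ⊤) (hder : IsUnit (aeval y (derivative (minpoly R y)))) :
    IsIntegrallyClosed B := by
  let k := FractionRing R
  let F := FractionRing B
  let : Algebra k F := FractionRing.liftAlgebra R F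
  have : IsScalarTower R k F := FractionRing.isScalarTower_liftAlgebra R F
  have hyF : IsIntegral R (algebraMap B F y) := hy.map (IsScalarTower.toAlgHom R B F)
  have hyk : IsIntegral k (algebraMap B F y) := hyF.tower_top
  have hderF := aeval_derivative_minpoly_algebraMap k F hy
  have htop := intermediateField_adjoin_algebraMap_eq_top (F := F) k hadj
  have hadjF : Algebra.adjoin k {algebraMap B F y} = ⊤ := by
    rw [← IntermediateField.adjoin_simple_toSubalgebra_of_isAlgebraic hyk.isAlgebraic, htop,
      IntermediateField.top_toSubalgebra]
  have : Algebra.IsSeparable k F := algebra_isSeparable_of_adjoin_eq_top htop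
    (isSeparable_of_aeval_derivative_minpoly_ne_zero hyk
      (hderF ▸ (hder.map (algebraMap B F)).ne_zero))
  have : FiniteDimensional k F := (PowerBasis.ofAdjoinEqTop hyk hadjF).finite
  have : Algebra.IsIntegral R B :=
    ⟨fun b ↦ adjoin_le_integralClosure hy (hadj ▸ Algebra.mem_top : b ∈ Algebra.adjoin R {y})⟩
  refine (isIntegrallyClosed_iff F).mpr fun {z} hz ↦ ?_
  suffices hzmem : z ∈ Algebra.adjoin R {algebraMap B F y} by
    rwa [adjoin_algebraMap_eq_range hadj] at hzmem
  refine mem_adjoin_of_inv_aeval_derivative_minpoly_mem k hadjF hyF ?_ (isIntegral_trans z hz)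
  obtain ⟨u, hu⟩ := hder
  rw [adjoin_algebraMap_eq_range hadj, hderF, ← hu]
  exact ⟨↑u⁻¹, (map_units_inv (algebraMap B F) u)⟩

end IntegrallyClosed

theorem map_aevalAeval {K A B : Type*} [CommRing K] [CommRing A] [CommRing B]
    [Algebra K A] [Algebra K B] (φ : A →ₐ[K] B) (x y : A) (p : K[X][X]) :
    φ (aevalAeval x y p) = aevalAeval (φ x) (φ y) p := by
  have h : φ.comp (aevalAeval x y) = aevalAeval (φ x) (φ y) := by
    ext <;> simp
  exact DFunLike.congr_fun h p

namespace PlaneCurve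

section CoordinateRing

variable {K : Type*} [Field K] (f : MvPolynomial (Fin 2) K)

/-- The coordinate function `x` (for `i = 0`) or `y` (for `i = 1`) as an element of the coordinate
ring; its image in the function field is `coord f i`. -/
noncomputable def ringCoord (i : Fin 2) : CoordinateRing f :=
  Ideal.Quotient.mk (Ideal.span {f}) (MvPolynomial.X i)

theorem algebraMap_ringCoord (i : Fin 2) :
    algebraMap (CoordinateRing f) (FunctionField f) (ringCoord f i) = coord f i :=
  rfl

theorem aevalAeval_ringCoord_surjective :
    Function.Surjective (aevalAeval (R := K) (ringCoord f 0) (ringCoord f 1)) := by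
  intro a
  obtain ⟨b, rfl⟩ := Ideal.Quotient.mkₐ_surjective K _ a
  obtain ⟨p, rfl⟩ := (Bivariate.equivMvPolynomial K).surjective b
  exact ⟨p, (map_aevalAeval (Ideal.Quotient.mkₐ K (Ideal.span {f})) _ _ p).symm⟩

theorem algebraMap_aevalAeval_ringCoord (p : K[X][X]) :
    algebraMap (CoordinateRing f) (FunctionField f)
      (aevalAeval (ringCoord f 0) (ringCoord f 1) p) = aevalAeval (coord f 0) (coord f 1) p :=
  map_aevalAeval (IsScalarTower.toAlgHom K (CoordinateRing f) (FunctionField f)) _ _ p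

variable {f} in
theorem algebraMap_mem_of_coord_mem [IsDomain (CoordinateRing f)] {Q : Place K (FunctionField f)}
    (hx : coord f 0 ∈ Q.ring) (hy : coord f 1 ∈ Q.ring) (a : CoordinateRing f) :
    algebraMap _ (FunctionField f) a ∈ Q.ring := by
  obtain ⟨p, rfl⟩ := aevalAeval_ringCoord_surjective f a
  rw [algebraMap_aevalAeval_ringCoord]
  have hp := map_aevalAeval Q.subalgebra.val ⟨_, hx⟩ ⟨_, hy⟩ p
  exact hp ▸ Subtype.property _

/-- The `K[X]`-algebra structure on the coordinate ring in which `X` acts as `x`, so that `y`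
generates the algebra. -/
@[reducible] noncomputable def algebraCoordinateRing : Algebra K[X] (CoordinateRing f) :=
  (aeval (ringCoord f 0)).toRingHom.toAlgebra

attribute [local instance] algebraCoordinateRing

theorem aeval_ringCoord (p : K[X][X]) :
    aeval (ringCoord f 1) p = aevalAeval (ringCoord f 0) (ringCoord f 1) p := by
  induction p using Polynomial.induction_on' with
  | add p q hp hq => rw [map_add, map_add, hp, hq]
  | monomial n a =>
    rw [aeval_monomial, ← C_mul_X_pow_eq_monomial, map_mul, map_pow, aevalAeval_C, aevalAeval_Y]
    rfl

theorem adjoin_ringCoord_eq_top : Algebra.adjoin K[X] {ringCoord f 1} = ⊤ := by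
  refine eq_top_iff.mpr fun a _ ↦ ?_
  obtain ⟨p, rfl⟩ := aevalAeval_ringCoord_surjective f a
  rw [← aeval_ringCoord]
  exact aeval_mem_adjoin_singleton _ _

end CoordinateRing

section BivariateSeparated

variable {K : Type*} [CommRing K] {T : K[X]} {ω : K} {m : ℕ}

/-- The polynomial `T(Y) + ω X ^ m`, defining a curve with separated variables. -/
noncomputable def separatedCurve (T : K[X]) (ω : K) (m : ℕ) : MvPolynomial (Fin 2) K :=
  aeval (MvPolynomial.X 1) T + MvPolynomial.C ω * MvPolynomial.X 0 ^ m

/-- The polynomial `T(Y) + ω X ^ m` as a polynomial in `Y` with coefficients in `K[X]`. -/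
noncomputable def bivariateSeparated (T : K[X]) (ω : K) (m : ℕ) : K[X][X] :=
  T.map C + C (C ω * X ^ m)

theorem aevalAeval_map_C {A : Type*} [CommRing A] [Algebra K A] (x y : A) :
    aevalAeval x y (T.map C) = aeval y T := by
  rw [← Bivariate.swap_C, Bivariate.aevalAeval_swap, aevalAeval_C]

theorem aevalAeval_bivariateSeparated {A : Type*} [CommRing A] [Algebra K A] (x y : A) :
    aevalAeval x y (bivariateSeparated T ω m) = aeval y T + algebraMap K A ω * x ^ m := by
  rw [bivariateSeparated, map_add, aevalAeval_map_C, aevalAeval_C, map_mul, map_pow, aeval_C,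
    aeval_X]

theorem natDegree_bivariateSeparated : (bivariateSeparated T ω m).natDegree = T.natDegree := by
  rw [bivariateSeparated, natDegree_add_C, natDegree_map_eq_of_injective C_injective]

theorem monic_bivariateSeparated (hT : T.Monic) (hT0 : T.natDegree ≠ 0) :
    (bivariateSeparated T ω m).Monic := by
  refine (hT.map C).add_of_left (degree_C_le.trans_lt ?_)
  rw [degree_map_eq_of_injective C_injective]
  exact natDegree_pos_iff_degree_pos.mp (Nat.pos_of_ne_zero hT0)

theorem derivative_bivariateSeparated :
    derivative (bivariateSeparated T ω m) = (derivative T).map C := by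
  rw [bivariateSeparated, derivative_add, derivative_C, add_zero, derivative_map]

end BivariateSeparated

section SeparatedCoordinateRing

variable {K : Type*} [Field K] {T : K[X]} {ω : K} {m : ℕ}

local notation "crv" => separatedCurve T ω m

theorem ringCoord_relation :
    aeval (ringCoord crv 1) T + algebraMap K _ ω * ringCoord crv 0 ^ m = 0 := by
  have h : Ideal.Quotient.mkₐ K (Ideal.span {crv}) (aeval (MvPolynomial.X 1) T +
      algebraMap K _ ω * MvPolynomial.X 0 ^ m) = 0 :=
    Ideal.Quotient.eq_zero_iff_mem.mpr (Ideal.mem_span_singleton_self _)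
  rwa [map_add, ← aeval_algHom_apply, map_mul, map_pow, AlgHom.commutes] at h

theorem map_ringCoord_relation {L : Type*} [CommRing L] [Algebra K L]
    (ψ : CoordinateRing crv →ₐ[K] L) :
    aeval (ψ (ringCoord crv 1)) T + algebraMap K L ω * ψ (ringCoord crv 0) ^ m = 0 := by
  rw [aeval_algHom_apply, ← map_pow, ← ψ.commutes, ← map_mul, ← map_add, ringCoord_relation,
    map_zero]

theorem exists_algHom_ringCoord_eq {L : Type*} [CommRing L] [Algebra K L] {x y : L}
    (hxy : aeval y T + algebraMap K L ω * x ^ m = 0) :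
    ∃ ψ : CoordinateRing crv →ₐ[K] L, ψ (ringCoord crv 0) = x := by
  have h : ∀ a ∈ Ideal.span {crv}, MvPolynomial.aeval ![x, y] a = 0 := by
    intro a ha
    obtain ⟨b, rfl⟩ := Ideal.mem_span_singleton.mp ha
    rw [map_mul, separatedCurve, map_add, ← aeval_algHom_apply, map_mul, map_pow]
    simp [hxy]
  exact ⟨Ideal.Quotient.liftₐ _ (MvPolynomial.aeval ![x, y]) h, MvPolynomial.aeval_X _ _⟩

theorem exists_natDegree_lt_aevalAeval_ringCoord_eq (hT : T.Monic) (hT0 : T.natDegree ≠ 0)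
    (a : CoordinateRing crv) : ∃ p : K[X][X], p.natDegree < T.natDegree ∧
      aevalAeval (ringCoord crv 0) (ringCoord crv 1) p = a := by
  obtain ⟨p, rfl⟩ := aevalAeval_ringCoord_surjective _ a
  have hmonic := monic_bivariateSeparated (ω := ω) (m := m) hT hT0
  have hdeg := natDegree_bivariateSeparated (T := T) (ω := ω) (m := m)
  refine ⟨p %ₘ bivariateSeparated T ω m, ?_, ?_⟩
  · rw [← hdeg]
    refine natDegree_modByMonic_lt p hmonic fun h ↦ hT0 ?_
    rw [← hdeg, h, natDegree_one]
  · conv_rhs => rw [← modByMonic_add_div p (bivariateSeparated T ω m)]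
    rw [map_add, map_mul, aevalAeval_bivariateSeparated, ringCoord_relation, zero_mul, add_zero]

variable (T ω m) in
theorem exists_algHom_ringCoord_notMem (hT0 : T.natDegree ≠ 0) :
    ∃ (P : Place K (AlgebraicClosure (RatFunc K)))
      (ψ : CoordinateRing crv →ₐ[K] AlgebraicClosure (RatFunc K)),
        ψ (ringCoord crv 0) ∉ P.ring := by
  let L := AlgebraicClosure (RatFunc K)
  let x : L := algebraMap (RatFunc K) L RatFunc.X
  have hx : Transcendental K x :=
    (transcendental_algebraMap_iff (algebraMap (RatFunc K) L).injective).mpr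
      RatFunc.transcendental_X
  obtain ⟨P, -, hxP⟩ := Place.exists_notMem_of_not_isIntegral (K := K) (A := K)
    (mt IsIntegral.isAlgebraic hx)
  obtain ⟨y, hy⟩ : ∃ y : L, (T.map (algebraMap K L) + C (algebraMap K L ω * x ^ m)).IsRoot y := by
    refine IsAlgClosed.exists_root _ fun h ↦ hT0 ?_
    have := natDegree_eq_of_degree_eq_some h
    rwa [natDegree_add_C, natDegree_map] at this
  have hxy : aeval y T + algebraMap K L ω * x ^ m = 0 := by
    simpa only [IsRoot.def, eval_add, eval_map_algebraMap, eval_C] using hy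
  obtain ⟨ψ, hψ⟩ := exists_algHom_ringCoord_eq hxy
  exact ⟨P, ψ, hψ ▸ hxP⟩

section Place

variable {L : Type*} [Field L] [Algebra K L] {P : Place K L}

theorem exists_valuation_aevalAeval_eq_pow {x y : L} (hω : ω ≠ 0) (hm : m ≠ 0)
    (hT0 : T.natDegree ≠ 0) (hcop : T.natDegree.Coprime m)
    (hxy : aeval y T + algebraMap K L ω * x ^ m = 0) (hx : x ∉ P.ring) :
    ∃ s : L, 1 < P.ring.valuation s ∧ P.ring.valuation x = P.ring.valuation s ^ T.natDegree ∧
      P.ring.valuation y = P.ring.valuation s ^ m ∧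
      ∀ p : K[X][X], p ≠ 0 → p.natDegree < T.natDegree → P.ring.valuation (aevalAeval x y p) =
        P.ring.valuation s ^ weightedDegree T.natDegree m p := by
  obtain ⟨s, hs, hsx, hsy⟩ := Place.exists_valuation_eq_pow hω hm hT0 hcop hxy hx
  exact ⟨s, hs, hsx, hsy, fun p hp hpn ↦
    valuation_aevalAeval_eq_pow_weightedDegree hcop hs hsx hsy hp hpn⟩

theorem map_aevalAeval_ringCoord_ne_zero (hω : ω ≠ 0) (hm : m ≠ 0)
    (hT0 : T.natDegree ≠ 0) (hcop : T.natDegree.Coprime m) {ψ : CoordinateRing crv →ₐ[K] L}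
    (hψ : ψ (ringCoord crv 0) ∉ P.ring) {p : K[X][X]} (hp : p ≠ 0)
    (hpn : p.natDegree < T.natDegree) :
    ψ (aevalAeval (ringCoord crv 0) (ringCoord crv 1) p) ≠ 0 := by
  obtain ⟨s, hs, -, -, hval⟩ :=
    exists_valuation_aevalAeval_eq_pow hω hm hT0 hcop (map_ringCoord_relation ψ) hψ
  rw [map_aevalAeval, ← P.ring.valuation.ne_zero_iff, hval p hp hpn]
  exact pow_ne_zero _ (zero_lt_one.trans hs).ne'

end Place

theorem aevalAeval_ringCoord_ne_zero (hω : ω ≠ 0) (hm : m ≠ 0) (hT0 : T.natDegree ≠ 0)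
    (hcop : T.natDegree.Coprime m) {p : K[X][X]} (hp : p ≠ 0) (hpn : p.natDegree < T.natDegree) :
    aevalAeval (ringCoord crv 0) (ringCoord crv 1) p ≠ 0 := by
  obtain ⟨P, ψ, hψ⟩ := exists_algHom_ringCoord_notMem T ω m hT0
  exact ne_zero_of_map (map_aevalAeval_ringCoord_ne_zero hω hm hT0 hcop hψ hp hpn)

theorem isDomain_coordinateRing (hω : ω ≠ 0) (hm : m ≠ 0) (hT : T.Monic)
    (hT0 : T.natDegree ≠ 0) (hcop : T.natDegree.Coprime m) : IsDomain (CoordinateRing crv) := by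
  obtain ⟨P, ψ, hψ⟩ := exists_algHom_ringCoord_notMem T ω m hT0
  have hinj : Function.Injective ψ := by
    refine (injective_iff_map_eq_zero ψ).mpr fun a ha ↦ ?_
    obtain ⟨p, hpn, rfl⟩ := exists_natDegree_lt_aevalAeval_ringCoord_eq hT hT0 a
    by_contra hne
    have hp : p ≠ 0 := by
      rintro rfl
      exact hne (map_zero _)
    exact map_aevalAeval_ringCoord_ne_zero hω hm hT0 hcop hψ hp hpn ha
  exact hinj.isDomain ψ.toRingHom

theorem transcendental_ringCoord (hω : ω ≠ 0) (hm : m ≠ 0) (hT0 : T.natDegree ≠ 0)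
    (hcop : T.natDegree.Coprime m) : Transcendental K (ringCoord crv 0) := by
  rw [transcendental_iff]
  intro a ha
  by_contra ha0
  refine aevalAeval_ringCoord_ne_zero hω hm hT0 hcop (C_ne_zero.mpr ha0) ?_
    ((aevalAeval_C _ _ a).trans ha)
  rw [natDegree_C]
  exact Nat.pos_of_ne_zero hT0

section IntegrallyClosed

attribute [local instance] algebraCoordinateRing

theorem aeval_ringCoord_bivariateSeparated :
    aeval (ringCoord crv 1) (bivariateSeparated T ω m) = 0 := by
  rw [aeval_ringCoord, aevalAeval_bivariateSeparated, ringCoord_relation]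

theorem minpoly_ringCoord (hω : ω ≠ 0) (hm : m ≠ 0) (hT : T.Monic) (hT0 : T.natDegree ≠ 0)
    (hcop : T.natDegree.Coprime m) :
    minpoly K[X] (ringCoord crv 1) = bivariateSeparated T ω m := by
  refine (minpoly.unique' _ _ (monic_bivariateSeparated hT hT0) aeval_ringCoord_bivariateSeparated
    fun p hp ↦ or_iff_not_imp_left.mpr fun hp0 ↦ ?_).symm
  rw [aeval_ringCoord]
  refine aevalAeval_ringCoord_ne_zero hω hm hT0 hcop hp0 ?_
  rw [← natDegree_bivariateSeparated (ω := ω) (m := m)]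
  exact natDegree_lt_natDegree hp0 hp

theorem isIntegrallyClosed_coordinateRing (hω : ω ≠ 0) (hm : m ≠ 0) (hT : T.Monic)
    (hT0 : T.natDegree ≠ 0) (hcop : T.natDegree.Coprime m) (hder : IsUnit (derivative T))
    [IsDomain (CoordinateRing crv)] : IsIntegrallyClosed (CoordinateRing crv) := by
  have : FaithfulSMul K[X] (CoordinateRing crv) :=
    (faithfulSMul_iff_algebraMap_injective _ _).mpr
      (transcendental_iff_injective.mp (transcendental_ringCoord hω hm hT0 hcop))
  refine isIntegrallyClosed_of_isUnit_aeval_derivative_minpoly (R := K[X])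
    ⟨_, monic_bivariateSeparated hT hT0, aeval_ringCoord_bivariateSeparated⟩
    (adjoin_ringCoord_eq_top _) ?_
  rw [minpoly_ringCoord hω hm hT hT0 hcop, derivative_bivariateSeparated]
  exact (hder.map (mapRingHom C)).map (aeval _)

end IntegrallyClosed

end SeparatedCoordinateRing

section PlaceAtInfinity

variable {K : Type*} [Field K] {T : K[X]} {ω : K} {m : ℕ}

local notation "crv" => separatedCurve T ω m

variable (T ω m) in
theorem coord_relation :
    aeval (coord crv 1) T + algebraMap K (FunctionField crv) ω * coord crv 0 ^ m = 0 :=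
  map_ringCoord_relation (IsScalarTower.toAlgHom K (CoordinateRing crv) (FunctionField crv))

variable [IsDomain (CoordinateRing (separatedCurve T ω m))]

theorem exists_place_coord_notMem (hω : ω ≠ 0) (hm : m ≠ 0) (hT0 : T.natDegree ≠ 0)
    (hcop : T.natDegree.Coprime m) :
    ∃ P : Place K (FunctionField crv), coord crv 0 ∉ P.ring := by
  have hx : Transcendental K (coord crv 0) :=
    (transcendental_algebraMap_iff
      (IsFractionRing.injective (CoordinateRing crv) (FunctionField crv))).mpr
      (transcendental_ringCoord hω hm hT0 hcop)
  obtain ⟨P, -, hP⟩ := Place.exists_notMem_of_not_isIntegral (K := K) (A := K)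
    (mt IsIntegral.isAlgebraic hx)
  exact ⟨P, hP⟩

theorem exists_div_aevalAeval_coord_eq (hT : T.Monic) (hT0 : T.natDegree ≠ 0)
    {z : FunctionField crv} (hz : z ≠ 0) : ∃ p q : K[X][X], p ≠ 0 ∧ p.natDegree < T.natDegree ∧
      q ≠ 0 ∧ q.natDegree < T.natDegree ∧
      aevalAeval (coord crv 0) (coord crv 1) p / aevalAeval (coord crv 0) (coord crv 1) q = z := by
  obtain ⟨a, b, -, rfl⟩ := IsFractionRing.div_surjective (A := CoordinateRing crv) z
  obtain ⟨p, hpn, rfl⟩ := exists_natDegree_lt_aevalAeval_ringCoord_eq hT hT0 a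
  obtain ⟨q, hqn, rfl⟩ := exists_natDegree_lt_aevalAeval_ringCoord_eq hT hT0 b
  refine ⟨p, q, ?_, hpn, ?_, hqn, by simp only [algebraMap_aevalAeval_ringCoord]⟩
  all_goals
    rintro rfl
    simp at hz

theorem div_aevalAeval_coord_mem_iff (hω : ω ≠ 0) (hm : m ≠ 0) (hT0 : T.natDegree ≠ 0)
    (hcop : T.natDegree.Coprime m) {P : Place K (FunctionField crv)} (hP : coord crv 0 ∉ P.ring)
    {p q : K[X][X]} (hp : p ≠ 0) (hpn : p.natDegree < T.natDegree) (hq : q ≠ 0)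
    (hqn : q.natDegree < T.natDegree) :
    aevalAeval (coord crv 0) (coord crv 1) p / aevalAeval (coord crv 0) (coord crv 1) q ∈ P.ring ↔
      weightedDegree T.natDegree m p ≤ weightedDegree T.natDegree m q := by
  obtain ⟨s, hs, -, -, hval⟩ :=
    exists_valuation_aevalAeval_eq_pow hω hm hT0 hcop (coord_relation T ω m) hP
  rw [← P.ring.valuation_le_one_iff, map_div₀, hval p hp hpn, hval q hq hqn,
    div_le_one₀ (pow_pos (zero_lt_one.trans hs) _), pow_le_pow_iff_right₀ hs]

theorem place_eq_of_coord_notMem (hω : ω ≠ 0) (hm : m ≠ 0) (hT : T.Monic)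
    (hT0 : T.natDegree ≠ 0) (hcop : T.natDegree.Coprime m) {P Q : Place K (FunctionField crv)}
    (hP : coord crv 0 ∉ P.ring) (hQ : coord crv 0 ∉ Q.ring) : P = Q := by
  refine Place.ring_injective (ValuationSubring.ext _ _ fun z ↦ ?_)
  rcases eq_or_ne z 0 with rfl | hz
  · simp only [zero_mem]
  obtain ⟨p, q, hp, hpn, hq, hqn, rfl⟩ := exists_div_aevalAeval_coord_eq hT hT0 hz
  rw [div_aevalAeval_coord_mem_iff hω hm hT0 hcop hP hp hpn hq hqn,
    div_aevalAeval_coord_mem_iff hω hm hT0 hcop hQ hp hpn hq hqn]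

theorem forall_mem_ring_iff (hω : ω ≠ 0) (hm : m ≠ 0) (hT : T.Monic) (hT0 : T.natDegree ≠ 0)
    (hcop : T.natDegree.Coprime m) (hder : IsUnit (derivative T))
    {P : Place K (FunctionField crv)} (hP : coord crv 0 ∉ P.ring) (z : FunctionField crv) :
    (∀ Q : Place K (FunctionField crv), Q ≠ P → z ∈ Q.ring) ↔
      ∃ a : CoordinateRing crv, algebraMap _ _ a = z := by
  constructor
  · intro h
    have := isIntegrallyClosed_coordinateRing hω hm hT hT0 hcop hder
    by_contra hz
    obtain ⟨Q, hQ, hzQ⟩ := Place.exists_notMem_of_not_isIntegral (K := K)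
      (mt IsIntegrallyClosed.isIntegral_iff.mp hz)
    refine hzQ (h Q ?_)
    rintro rfl
    exact hP (hQ (ringCoord _ 0))
  · rintro ⟨a, rfl⟩ Q hQ
    have hx : coord crv 0 ∈ Q.ring :=
      not_not.mp fun hx ↦ hQ (place_eq_of_coord_notMem hω hm hT hT0 hcop hx hP)
    exact algebraMap_mem_of_coord_mem hx
      ((Place.mem_ring_iff_mem_ring hω hm hT0 (coord_relation T ω m)).mp hx) a

theorem exists_isLocalParameter_valuation_aevalAeval_eq_pow (hω : ω ≠ 0) (hm : m ≠ 0)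
    (hT : T.Monic) (hT0 : T.natDegree ≠ 0) (hcop : T.natDegree.Coprime m)
    {P : Place K (FunctionField crv)} (hP : coord crv 0 ∉ P.ring) :
    ∃ s : FunctionField crv, P.IsLocalParameter s⁻¹ ∧ 1 < P.ring.valuation s ∧
      P.ring.valuation (coord crv 0) = P.ring.valuation s ^ T.natDegree ∧
      P.ring.valuation (coord crv 1) = P.ring.valuation s ^ m ∧
      ∀ p : K[X][X], p ≠ 0 → p.natDegree < T.natDegree →
        P.ring.valuation (aevalAeval (coord crv 0) (coord crv 1) p) =
          P.ring.valuation s ^ weightedDegree T.natDegree m p := by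
  obtain ⟨s, hs, hsx, hsy, hval⟩ :=
    exists_valuation_aevalAeval_eq_pow hω hm hT0 hcop (coord_relation T ω m) hP
  refine ⟨s, Place.isLocalParameter_inv hs fun z hz ↦ ?_, hs, hsx, hsy, hval⟩
  obtain ⟨p, q, hp, hpn, hq, hqn, rfl⟩ := exists_div_aevalAeval_coord_eq hT hT0 hz
  refine ⟨weightedDegree T.natDegree m p - weightedDegree T.natDegree m q, ?_⟩
  rw [map_div₀, hval p hp hpn, hval q hq hqn, zpow_sub₀ (zero_lt_one.trans hs).ne', zpow_natCast,
    zpow_natCast]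

theorem weierstrassSemigroup_eq (hω : ω ≠ 0) (hm : m ≠ 0) (hT : T.Monic) (hT0 : T.natDegree ≠ 0)
    (hcop : T.natDegree.Coprime m) (hder : IsUnit (derivative T))
    {P : Place K (FunctionField crv)} (hP : coord crv 0 ∉ P.ring) :
    P.weierstrassSemigroup = (AddSubmonoid.closure {T.natDegree, m} : AddSubmonoid ℕ) := by
  obtain ⟨s, hpar, hs, hsx, hsy, hval⟩ :=
    exists_isLocalParameter_valuation_aevalAeval_eq_pow hω hm hT hT0 hcop hP
  have hs0 : P.ring.valuation s ≠ 0 := (zero_lt_one.trans hs).ne'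
  ext k
  simp only [Place.weierstrassSemigroup, Set.mem_ofPred_eq, SetLike.mem_coe,
    forall_mem_ring_iff hω hm hT hT0 hcop hder hP,
    hpar.hasPoleOrder_iff ((P.ring.valuation.ne_zero_iff).mp hs0)]
  constructor
  · rintro ⟨_, ⟨a, rfl⟩, hk⟩
    obtain ⟨p, hpn, rfl⟩ := exists_natDegree_lt_aevalAeval_ringCoord_eq hT hT0 a
    rw [algebraMap_aevalAeval_ringCoord] at hk
    have hp : p ≠ 0 := by
      rintro rfl
      rw [map_zero, map_zero] at hk
      exact pow_ne_zero _ hs0 hk.symm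
    rw [hval p hp hpn, (pow_right_injective₀ (zero_lt_one.trans hs) hs.ne').eq_iff] at hk
    exact hk ▸ weightedDegree_mem_closure _ _ p
  · rw [AddSubmonoid.mem_closure_pair]
    rintro ⟨i, j, rfl⟩
    refine ⟨coord crv 0 ^ i * coord crv 1 ^ j, ⟨ringCoord _ 0 ^ i * ringCoord _ 1 ^ j, ?_⟩, ?_⟩
    · rw [map_mul, map_pow, map_pow, algebraMap_ringCoord, algebraMap_ringCoord]
    · rw [map_mul, map_pow, map_pow, hsx, hsy, ← pow_mul, ← pow_mul, ← pow_add, smul_eq_mul,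
        smul_eq_mul, mul_comm i, mul_comm j]

end PlaceAtInfinity

section PointAtInfinity

variable {K : Type*} [Field K] {f : MvPolynomial (Fin 2) K}

theorem eval_homogenization_of_eq_zero {w : Fin 3 → K} (hw : w 2 = 0) :
    MvPolynomial.eval w (homogenization f) =
      MvPolynomial.eval ![w 0, w 1] (MvPolynomial.homogeneousComponent f.totalDegree f) := by
  have hw' : w ∘ Fin.castSucc = ![w 0, w 1] := by
    ext i
    fin_cases i <;> rfl
  rw [homogenization, map_sum, Finset.sum_range_succ, Finset.sum_eq_zero, zero_add, Nat.sub_self,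
    pow_zero, mul_one, MvPolynomial.eval_rename, hw']
  intro i hi
  have hi' : f.totalDegree - i ≠ 0 := (Nat.sub_pos_of_lt (Finset.mem_range.mp hi)).ne'
  rw [map_mul, map_pow, MvPolynomial.eval_X, hw, zero_pow hi', mul_zero]

theorem isPointAtInfinity_iff_eq_mk {u w : K} (huw : ![u, w, 0] ≠ 0)
    (hf : ∀ a b : K, MvPolynomial.eval ![a, b]
      (MvPolynomial.homogeneousComponent f.totalDegree f) = 0 ↔ ∃ c, c * u = a ∧ c * w = b)
    (pt : Projectivization K (Fin 3 → K)) :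
    IsPointAtInfinity f pt ↔ pt = Projectivization.mk K _ huw := by
  have hmk : pt = Projectivization.mk K _ huw ↔
      (∃ c, c * u = pt.rep 0 ∧ c * w = pt.rep 1) ∧ pt.rep 2 = 0 := by
    conv_lhs => rw [← pt.mk_rep, Projectivization.mk_eq_mk_iff']
    simp [funext_iff, Fin.forall_fin_succ, eq_comm, ← and_assoc]
  rw [hmk, IsPointAtInfinity]
  refine and_congr_left fun h2 ↦ ?_
  rw [eval_homogenization_of_eq_zero h2, hf]

variable [IsDomain (CoordinateRing f)] {P : Place K (FunctionField f)}

theorem isCentredAt_mk {w : Fin 3 → K} (hw : w ≠ 0) {c : FunctionField f}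
    (hc : ∀ i, P.ring.valuation
      (c * ![coord f 0, coord f 1, 1] i - algebraMap K (FunctionField f) (w i)) < 1) :
    IsCentredAt f P (Projectivization.mk K w hw) := by
  obtain ⟨l, hl⟩ := Projectivization.exists_smul_eq_mk_rep K w hw
  refine ⟨algebraMap K _ (l : K) * c, fun i ↦ ?_⟩
  rw [← hl, Pi.smul_apply, Units.smul_def, smul_eq_mul, map_mul, mul_assoc, ← mul_sub, map_mul,
    Valuation.IsTrivialOn.eq_one (l : K) l.ne_zero, one_mul]
  exact hc i

theorem isCentredAt_mk_zero_one_zero (h : ![(0 : K), 1, 0] ≠ 0)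
    (hy : 1 < P.ring.valuation (coord f 1))
    (hxy : P.ring.valuation (coord f 0) < P.ring.valuation (coord f 1)) :
    IsCentredAt f P (Projectivization.mk K _ h) := by
  have hy0 : coord f 1 ≠ 0 := (Valuation.ne_zero_iff _).mp (zero_lt_one.trans hy).ne'
  refine isCentredAt_mk h (c := (coord f 1)⁻¹) fun i ↦ ?_
  fin_cases i
  · simpa [inv_mul_lt_one₀ (zero_lt_one.trans hy)] using hxy
  · simp [hy0]
  · simpa using inv_lt_one_of_one_lt₀ hy

theorem isCentredAt_mk_one_zero {w : K} (h : ![1, w, 0] ≠ 0)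
    (hx : 1 < P.ring.valuation (coord f 0))
    (hw : P.ring.valuation (coord f 1 - algebraMap K _ w * coord f 0) <
      P.ring.valuation (coord f 0)) :
    IsCentredAt f P (Projectivization.mk K _ h) := by
  have hx0 : coord f 0 ≠ 0 := (Valuation.ne_zero_iff _).mp (zero_lt_one.trans hx).ne'
  have hdiv : (coord f 0)⁻¹ * coord f 1 - algebraMap K _ w =
      (coord f 0)⁻¹ * (coord f 1 - algebraMap K _ w * coord f 0) := by
    field_simp
  refine isCentredAt_mk h (c := (coord f 0)⁻¹) fun i ↦ ?_
  fin_cases i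
  · simp [hx0]
  · simpa [hdiv, inv_mul_lt_one₀ (zero_lt_one.trans hx)] using hw
  · simpa using inv_lt_one_of_one_lt₀ hx

theorem IsCentredAt.not_coord_mem_and_coord_mem {pt : Projectivization K (Fin 3 → K)}
    (hP : IsCentredAt f P pt) (hpt : pt.rep 2 = 0) :
    ¬ (coord f 0 ∈ P.ring ∧ coord f 1 ∈ P.ring) := by
  rintro ⟨hx, hy⟩
  obtain ⟨c, hc⟩ := hP
  have hvc : P.ring.valuation c < 1 := by
    simpa [hpt] using hc 2
  have hzero {z : FunctionField f} {a : K} (hz : z ∈ P.ring)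
      (h : P.ring.valuation (c * z - algebraMap K _ a) < 1) : a = 0 := by
    by_contra ha
    have hcz : P.ring.valuation (c * z) < 1 := by
      rw [map_mul]
      exact (mul_le_of_le_one_right' ((P.ring.valuation_le_one_iff z).mpr hz)).trans_lt hvc
    have ha1 := P.ring.valuation.map_sub_lt hcz h
    rw [sub_sub_cancel, Valuation.IsTrivialOn.eq_one a ha] at ha1
    exact lt_irrefl _ ha1
  refine pt.rep_nonzero (funext fun i ↦ ?_)
  fin_cases i
  · exact hzero hx (hc 0)
  · exact hzero hy (hc 1)
  · exact hpt

end PointAtInfinity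

section SeparatedTotalDegree

variable {K : Type*} [CommRing K] {T : K[X]} {ω : K} {m : ℕ}

local notation "crv" => separatedCurve T ω m

theorem homogeneousComponent_X_pow (i : Fin 2) (j N : ℕ) :
    MvPolynomial.homogeneousComponent N (MvPolynomial.X i ^ j : MvPolynomial (Fin 2) K) =
      if j = N then MvPolynomial.X i ^ j else 0 :=
  (MvPolynomial.homogeneousComponent_of_mem ((MvPolynomial.mem_homogeneousSubmodule _ _).mpr
    (MvPolynomial.isHomogeneous_X_pow i j))).trans (if_congr eq_comm rfl rfl)

theorem homogeneousComponent_separatedCurve (N : ℕ) :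
    MvPolynomial.homogeneousComponent N crv =
      MvPolynomial.C (T.coeff N) * MvPolynomial.X 1 ^ N +
        if m = N then MvPolynomial.C ω * MvPolynomial.X 0 ^ m else 0 := by
  rw [separatedCurve, map_add, MvPolynomial.homogeneousComponent_C_mul, homogeneousComponent_X_pow,
    mul_ite, mul_zero, aeval_eq_sum_range' (n := max T.natDegree N + 1) (by omega), map_sum]
  simp only [map_smul, homogeneousComponent_X_pow, smul_ite, smul_zero]
  rw [Finset.sum_ite_eq_of_mem' _ _ _ (by simp), MvPolynomial.smul_eq_C_mul]

theorem eval_homogeneousComponent_separatedCurve (N : ℕ) (a b : K) :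
    MvPolynomial.eval ![a, b] (MvPolynomial.homogeneousComponent N crv) =
      T.coeff N * b ^ N + if m = N then ω * a ^ m else 0 := by
  rw [homogeneousComponent_separatedCurve]
  split_ifs <;> simp

variable [Nontrivial K]

theorem totalDegree_separatedCurve_le : (crv).totalDegree ≤ max T.natDegree m := by
  refine (MvPolynomial.totalDegree_add _ _).trans (max_le_max ?_ ?_)
  · rw [aeval_eq_sum_range]
    refine (MvPolynomial.totalDegree_finsetSum _ _).trans (Finset.sup_le fun i hi ↦ ?_)
    refine (MvPolynomial.totalDegree_smul_le _ _).trans ?_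
    rw [MvPolynomial.totalDegree_X_pow]
    exact Nat.lt_succ_iff.mp (Finset.mem_range.mp hi)
  · refine (MvPolynomial.totalDegree_mul _ _).trans ?_
    rw [MvPolynomial.totalDegree_C, MvPolynomial.totalDegree_X_pow, zero_add]

theorem totalDegree_separatedCurve (hω : ω ≠ 0) (hT : T.Monic) (hT0 : T.natDegree ≠ 0) :
    (crv).totalDegree = max T.natDegree m := by
  refine totalDegree_separatedCurve_le.antisymm (le_of_not_gt fun hlt ↦ ?_)
  have hzero (a b : K) : T.coeff (max T.natDegree m) * b ^ (max T.natDegree m) +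
      (if m = max T.natDegree m then ω * a ^ m else 0) = 0 := by
    rw [← eval_homogeneousComponent_separatedCurve,
      MvPolynomial.homogeneousComponent_eq_zero _ _ hlt, map_zero]
  rcases lt_or_ge T.natDegree m with h | h
  · have h10 := hzero 1 0
    rw [max_eq_right h.le, coeff_eq_zero_of_natDegree_lt h] at h10
    simp [hω] at h10
  · have h01 := hzero 0 1
    rw [max_eq_left h, hT.coeff_natDegree] at h01
    split_ifs at h01 with hmn <;> simp [hmn, hT0] at h01

end SeparatedTotalDegree

section SeparatedPointAtInfinity

variable {K : Type*} [Field K] {T : K[X]} {ω : K} {m : ℕ}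

local notation "crv" => separatedCurve T ω m

variable [IsDomain (CoordinateRing (separatedCurve T ω m))]

theorem exists_pointAtInfinity_of_natDegree_lt (hω : ω ≠ 0) (hT : T.Monic) (hT0 : T.natDegree ≠ 0)
    (hcop : T.natDegree.Coprime m) (hlt : T.natDegree < m) :
    ∃ pt : Projectivization K (Fin 3 → K), (∀ pt', IsPointAtInfinity crv pt' ↔ pt' = pt) ∧
      ∀ P : Place K (FunctionField crv), coord crv 0 ∉ P.ring → IsCentredAt crv P pt := by
  have hpt : ![(0 : K), 1, 0] ≠ 0 := fun h ↦ one_ne_zero (congrFun h 1)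
  have hm : m ≠ 0 := Nat.ne_zero_of_lt hlt
  refine ⟨_, isPointAtInfinity_iff_eq_mk hpt fun a b ↦ ?_, fun P hP ↦ ?_⟩
  · rw [totalDegree_separatedCurve hω hT hT0, max_eq_right hlt.le,
      eval_homogeneousComponent_separatedCurve, coeff_eq_zero_of_natDegree_lt hlt]
    simp [hω, hm, eq_comm]
  · obtain ⟨s, hs, hsx, hsy⟩ :=
      Place.exists_valuation_eq_pow hω hm hT0 hcop (coord_relation T ω m) hP
    refine isCentredAt_mk_zero_one_zero hpt (hsy ▸ one_lt_pow₀ hs hm) ?_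
    rw [hsx, hsy]
    exact pow_lt_pow_right₀ hs hlt

theorem exists_pointAtInfinity_of_lt_natDegree (hω : ω ≠ 0) (hm : m ≠ 0) (hT : T.Monic)
    (hcop : T.natDegree.Coprime m) (hlt : m < T.natDegree) :
    ∃ pt : Projectivization K (Fin 3 → K), (∀ pt', IsPointAtInfinity crv pt' ↔ pt' = pt) ∧
      ∀ P : Place K (FunctionField crv), coord crv 0 ∉ P.ring → IsCentredAt crv P pt := by
  have hpt : ![(1 : K), 0, 0] ≠ 0 := fun h ↦ one_ne_zero (congrFun h 0)
  have hT0 : T.natDegree ≠ 0 := Nat.ne_zero_of_lt hlt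
  refine ⟨_, isPointAtInfinity_iff_eq_mk hpt fun a b ↦ ?_, fun P hP ↦ ?_⟩
  · rw [totalDegree_separatedCurve hω hT hT0, max_eq_left hlt.le,
      eval_homogeneousComponent_separatedCurve, hT.coeff_natDegree]
    simp [hlt.ne, hT0, eq_comm (a := (0 : K)) (b := b)]
  · obtain ⟨s, hs, hsx, hsy⟩ :=
      Place.exists_valuation_eq_pow hω hm hT0 hcop (coord_relation T ω m) hP
    refine isCentredAt_mk_one_zero hpt (hsx ▸ one_lt_pow₀ hs hT0) ?_
    rw [map_zero, zero_mul, sub_zero, hsx, hsy]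
    exact pow_lt_pow_right₀ hs hlt

theorem exists_pointAtInfinity_of_natDegree_eq_one (hω : ω ≠ 0) (hT : T.Monic)
    (hT1 : T.natDegree = 1) (hm : m = 1) :
    ∃ pt : Projectivization K (Fin 3 → K), (∀ pt', IsPointAtInfinity crv pt' ↔ pt' = pt) ∧
      ∀ P : Place K (FunctionField crv), coord crv 0 ∉ P.ring → IsCentredAt crv P pt := by
  have hpt : ![1, -ω, 0] ≠ 0 := fun h ↦ one_ne_zero (congrFun h 0)
  refine ⟨_, isPointAtInfinity_iff_eq_mk hpt fun a b ↦ ?_, fun P hP ↦ ?_⟩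
  · rw [totalDegree_separatedCurve hω hT (hT1 ▸ one_ne_zero), hT1, hm, max_self,
      eval_homogeneousComponent_separatedCurve, if_pos rfl, ← hT1, hT.coeff_natDegree, hT1]
    simp [add_eq_zero_iff_eq_neg, mul_comm, eq_comm]
  · have hx : 1 < P.ring.valuation (coord crv 0) := by
      rwa [← P.ring.valuation_le_one_iff, not_le] at hP
    refine isCentredAt_mk_one_zero hpt hx ?_
    have hxy := coord_relation T ω m
    have haeval : aeval (coord crv 1) T = coord crv 1 + algebraMap K _ (T.coeff 0) := by
      conv_lhs => rw [aeval_def]; enter [3]; rw [hT.eq_X_add_C hT1]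
      simp
    have hpow : coord crv 0 ^ m = coord crv 0 := by
      conv_lhs => enter [2]; rw [hm]
      rw [pow_one]
    rw [haeval, hpow] at hxy
    have hsub : coord crv 1 - algebraMap K _ (-ω) * coord crv 0 =
        algebraMap K _ (-T.coeff 0) := by
      rw [map_neg, map_neg]
      linear_combination hxy
    rw [hsub]
    exact ((P.ring.valuation_le_one_iff _).mpr (P.algebraMap_mem _)).trans_lt hx

theorem exists_pointAtInfinity (hω : ω ≠ 0) (hm : m ≠ 0) (hT : T.Monic) (hT0 : T.natDegree ≠ 0)
    (hcop : T.natDegree.Coprime m) :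
    ∃ pt : Projectivization K (Fin 3 → K), (∀ pt', IsPointAtInfinity crv pt' ↔ pt' = pt) ∧
      ∀ P : Place K (FunctionField crv), coord crv 0 ∉ P.ring → IsCentredAt crv P pt := by
  rcases lt_trichotomy T.natDegree m with hlt | heq | hlt
  · exact exists_pointAtInfinity_of_natDegree_lt hω hT hT0 hcop hlt
  · have hT1 : T.natDegree = 1 := by rwa [← heq, Nat.coprime_self] at hcop
    exact exists_pointAtInfinity_of_natDegree_eq_one hω hT hT1 (heq ▸ hT1)
  · exact exists_pointAtInfinity_of_lt_natDegree hω hm hT hcop hlt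

end SeparatedPointAtInfinity

section SeparatedCurve

variable {K : Type*} [Field K] {T : K[X]} {ω : K} {m : ℕ}

theorem hasWeierstrassSemigroupAtInfinity_separatedCurve (hω : ω ≠ 0) (hm : m ≠ 0) (hT : T.Monic)
    (hcop : T.natDegree.Coprime m) (hder : IsUnit (derivative T)) :
    HasWeierstrassSemigroupAtInfinity (separatedCurve T ω m)
      (AddSubmonoid.closure {T.natDegree, m}) := by
  have hT0 : T.natDegree ≠ 0 := fun h ↦ hder.ne_zero (derivative_of_natDegree_zero h)
  have hdom := isDomain_coordinateRing hω hm hT hT0 hcop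
  obtain ⟨pt, hpt, hcentre⟩ := exists_pointAtInfinity hω hm hT hT0 hcop
  obtain ⟨P, hP⟩ := exists_place_coord_notMem hω hm hT0 hcop
  refine ⟨hdom, pt, hpt, P, fun Q ↦ ⟨fun hQ ↦ ?_, fun h ↦ h ▸ hcentre P hP⟩,
    weierstrassSemigroup_eq hω hm hT hT0 hcop hder hP⟩
  refine place_eq_of_coord_notMem hω hm hT hT0 hcop (fun hx ↦ ?_) hP
  exact hQ.not_coord_mem_and_coord_mem ((hpt pt).mpr rfl).2
    ⟨hx, (Place.mem_ring_iff_mem_ring hω hm hT0 (coord_relation T ω m)).mp hx⟩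

end SeparatedCurve

section Trace

/-- The polynomial `∑_{i=1}^h X^{q/p^i}`, where `q = p^h`; for `R = 𝔽_q` it is the trace to `𝔽_p`
as a polynomial function. -/
noncomputable def tracePolynomial (R : Type*) [Semiring R] (p h : ℕ) : R[X] :=
  ∑ i ∈ Finset.Icc 1 h, X ^ (p ^ h / p ^ i)

theorem traceCurve_eq_separatedCurve {K : Type*} [Field K] (p h : ℕ) (ω : K) (m : ℕ) :
    traceCurve p h ω m = separatedCurve (tracePolynomial K p h) ω m := by
  simp [traceCurve, separatedCurve, tracePolynomial]

variable {R : Type*} [Semiring R]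

theorem tracePolynomial_succ {p : ℕ} (hp : p ≠ 0) (h : ℕ) :
    tracePolynomial R p (h + 1) = ∑ i ∈ Finset.range (h + 1), X ^ p ^ i := by
  rw [← Finset.sum_range_reflect, tracePolynomial, ← Finset.Ico_add_one_right_eq_Icc,
    Finset.sum_Ico_eq_sum_range]
  refine Finset.sum_congr rfl fun i hi ↦ ?_
  have hih : i < h + 1 := Finset.mem_range.mp hi
  rw [Nat.pow_div (by omega) (Nat.pos_of_ne_zero hp)]
  congr 2
  omega

variable [Nontrivial R] in
theorem degree_sum_X_pow_pow_lt {p : ℕ} (hp : 1 < p) (h : ℕ) :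
    (∑ i ∈ Finset.range h, (X : R[X]) ^ p ^ i).degree < ((X : R[X]) ^ p ^ h).degree := by
  refine (degree_sum_le _ _).trans_lt ?_
  rw [degree_X_pow, Finset.sup_lt_iff (WithBot.bot_lt_coe _)]
  intro i hi
  rw [degree_X_pow]
  exact_mod_cast Nat.pow_lt_pow_right hp (Finset.mem_range.mp hi)

variable [Nontrivial R] in
theorem natDegree_tracePolynomial_succ {p : ℕ} (hp : 1 < p) (h : ℕ) :
    (tracePolynomial R p (h + 1)).natDegree = p ^ h := by
  rw [tracePolynomial_succ (by omega), Finset.sum_range_succ,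
    natDegree_add_eq_right_of_degree_lt (degree_sum_X_pow_pow_lt hp h), natDegree_X_pow]

variable [Nontrivial R] in
theorem monic_tracePolynomial_succ {p : ℕ} (hp : 1 < p) (h : ℕ) :
    (tracePolynomial R p (h + 1)).Monic := by
  rw [tracePolynomial_succ (by omega), Finset.sum_range_succ]
  exact (monic_X_pow _).add_of_right (degree_sum_X_pow_pow_lt hp h)

theorem derivative_tracePolynomial_succ {p : ℕ} (hp : p ≠ 0) [CharP R p] (h : ℕ) :
    derivative (tracePolynomial R p (h + 1)) = 1 := by
  rw [tracePolynomial_succ hp, Finset.sum_range_succ', derivative_add,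
    derivative_sum, Finset.sum_eq_zero, zero_add, pow_zero, pow_one, derivative_X]
  intro i _
  rw [derivative_X_pow, Nat.cast_pow, CharP.cast_eq_zero, zero_pow i.succ_ne_zero, map_zero,
    zero_mul]

end Trace

end PlaneCurve

theorem ne_zero_of_pow_eq_neg_one {R : Type*} [Ring R] [Nontrivial R] {a : R} {n : ℕ}
    (hn : n ≠ 0) (ha : a ^ n = -1) : a ≠ 0 := by
  rintro rfl
  simp [hn] at ha

theorem coprime_pow_div_of_dvd_pow_add_one {p h m : ℕ} (hh : h ≠ 0) (hm : m ∣ p ^ h + 1) :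
    (p ^ h / p).Coprime m :=
  (Nat.Coprime.coprime_dvd_left (Nat.div_dvd_of_dvd (dvd_pow_self p hh))
    (by simp : (p ^ h).Coprime (p ^ h + 1))).coprime_dvd_right hm

theorem mainTheorem3_general {K : Type*} [Field K] {p h m : ℕ} [Fact p.Prime] [CharP K p]
    (hh : 1 ≤ h) {ω : K} (hω : ω ≠ 0) (hm : m ≠ 0) (hcop : (p ^ h / p).Coprime m) :
    PlaneCurve.HasWeierstrassSemigroupAtInfinity (PlaneCurve.traceCurve p h ω m)
      (AddSubmonoid.closure {p ^ h / p, m}) := by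
  obtain ⟨h, rfl⟩ := Nat.exists_eq_add_of_le' hh
  have hp : p.Prime := Fact.out
  have hdeg := PlaneCurve.natDegree_tracePolynomial_succ (R := K) hp.one_lt h
  rw [pow_succ, Nat.mul_div_cancel _ hp.pos, ← hdeg] at hcop ⊢
  rw [PlaneCurve.traceCurve_eq_separatedCurve]
  exact PlaneCurve.hasWeierstrassSemigroupAtInfinity_separatedCurve hω hm
    (PlaneCurve.monic_tracePolynomial_succ hp.one_lt h) hcop
    (PlaneCurve.derivative_tracePolynomial_succ (R := K) hp.ne_zero h ▸ isUnit_one)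

theorem mainTheorem3 {K : Type*} [Field K] (p : ℕ) [Fact p.Prime] [CharP K p]
    (h q : ℕ) (hh : 1 ≤ h) (hq : q = p ^ h) (ω : K) (hω : ω ^ (q - 1) = -1) :
    (2 ≤ h →
      PlaneCurve.HasWeierstrassSemigroupAtInfinity
        (PlaneCurve.traceCurve p h ω (q + 1))
        (AddSubmonoid.closure {q / p, q + 1})) ∧
    (∀ d : ℕ, d ∣ q + 1 →
      PlaneCurve.HasWeierstrassSemigroupAtInfinity
        (PlaneCurve.traceCurve p h ω ((q + 1) / d))
        (AddSubmonoid.closure {q / p, (q + 1) / d})) := by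
  subst hq
  have hq1 : 1 < p ^ h := Nat.one_lt_pow (by omega) (Fact.out : p.Prime).one_lt
  have hω0 : ω ≠ 0 := ne_zero_of_pow_eq_neg_one (Nat.sub_ne_zero_of_lt hq1) hω
  have hdvd {m : ℕ} (hm : m ∣ p ^ h + 1) :
      PlaneCurve.HasWeierstrassSemigroupAtInfinity (PlaneCurve.traceCurve p h ω m)
        (AddSubmonoid.closure {p ^ h / p, m}) :=
    mainTheorem3_general hh hω0 (ne_zero_of_dvd_ne_zero (Nat.succ_ne_zero _) hm)
      (coprime_pow_div_of_dvd_pow_add_one (by omega) hm)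
  exact ⟨fun _ ↦ hdvd dvd_rfl, fun d hd ↦ hdvd (Nat.div_dvd_of_dvd hd)⟩
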